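/- Let $q$ be a prime power, $m\ge 1$ an integer and $\lambda\ge 1/2$ a real number. The $\lambda$-subfield weight on $\mathbb F_{q^m}$ is $\mathrm{wt}_\lambda(0)=0$, $\mathrm{wt}_\lambda(x)=1$ for $x\in\mathbb F_q\setminus\{0\}$ and $\mathrm{wt}_\lambda(x)=\lambda$ for $x\in\mathbb F_{q^m}\setminus\mathbb F_q$, extended additively over the coordinates to $\mathbb F_{q^m}^n$. For $r\ge 0$ let $B_{r,\lambda}(\mathbb F_{q^m}^n)=\{x\in\mathbb F_{q^m}^n : \mathrm{wt}_\lambda(x)\le r\}$. Let $u(n)\ge 0$ be radii such that the limit $U=\lim_{n\to\infty}u(n)/n$ exists, put $f(x)=1+(q-1)x+(q^m-q)x^\lambda$, and let $\rho\ge 0$ be a solution of $$U=\frac{\rho f'(\rho)}{f(\rho)}=\frac{(q-1)\rho+\lambda(q^m-q)\rho^\lambda}{1+(q-1)\rho+(q^m-q)\rho^\lambda},$$ where for $\rho=0$ the middle expression is disregarded and the right-hand side, which is $0$, is used. If $\rho\le 1$ (equivalently, $U$ is at most the average weight $\frac{(q-1)+\lambda(q^m-q)}{q^m}$ of an element of $\mathbb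 F_{q^m}$), then $$\lim_{n\to\infty}\frac1n\log_{q^m}\bigl|B_{u(n),\lambda}(\mathbb F_{q^m}^n)\bigr|=\log_{q^m}f(\rho)-U\log_{q^m}\rho ,$$ with the convention $0\cdot\log_{q^m}0=0$ in the case $\rho=U=0$. If $\rho>1$, then $$\lim_{n\to\infty}\frac1n\log_{q^m}\bigl|B_{u(n),\lambda}(\mathbb F_{q^m}^n)\bigr|=1 .$$ -/

import Mathlib

open Filter Topology

noncomputable section

open Classical in
/-- The `lam`-subfield weight of a single element of the extension field `K` of `F`. -/
def subfieldWeight (F : Type*) {K : Type*} [Field F] [Field K] [Algebra F K]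
    (lam : ℝ) (x : K) : ℝ :=
  if x = 0 then 0
  else if x ∈ Set.range (algebraMap F K) then 1
  else lam

/-- The `lam`-subfield weight of a vector, extended additively over the coordinates. -/
def subfieldWeightVec (F : Type*) {K : Type*} [Field F] [Field K] [Algebra F K]
    (lam : ℝ) {n : ℕ} (x : Fin n → K) : ℝ :=
  ∑ i, subfieldWeight F lam (x i)

/-- The ball of radius `r` around the origin of `K ^ n` in the `lam`-subfield metric. -/
def subfieldBall (F K : Type*) [Field F] [Field K] [Algebra F K]
    (lam : ℝ) (n : ℕ) (r : ℝ) : Set (Fin n → K) :=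
  {x | subfieldWeightVec F lam x ≤ r}

/-- The weight enumerator `1 + (q - 1) x + (q ^ m - q) x ^ lam` of the field of order `q ^ m`
over its subfield of order `q`. -/
def subfieldEnumerator (q m : ℕ) (lam x : ℝ) : ℝ :=
  1 + ((q : ℝ) - 1) * x + ((q : ℝ) ^ m - q) * x ^ lam

end

/-! Choose letters independently with probability `s ^ wt / f(s)`. Their mean weight is `M(s) = s
f'(s) / f(s)`, and a word of weight `w` has probability `s ^ w / f(s) ^ n`. For `0 < s ≤ 1` a word
in the ball of radius `r` has `s ^ w ≥ s ^ r`, so the ball has at most `f(s) ^ n / s ^ r` elements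
(`ncard_weightBall_mul_le`). Conversely, if `M(s) < U`, Chebyshev puts most of the mass on words in
the ball of weight near `n M(s)`, which must number about `f(s) ^ n / s ^ (n M(s))`
(`half_le_ncard_weightBall_mul`).

Since `M` is strictly increasing (`subfieldTiltedMean_lt`), letting `s ↑ ρ` in the lower bound meets
the upper bound at `s = ρ`. For `ρ = 0` the upper bound with small `s` suffices; for `ρ > 1` the
uniform distribution `s = 1` already has mean below `U`. -/

section Alphabet

variable {α : Type*} [Fintype α]

/-! ### Moments of sums of independent letters -/

/-- A product distribution on words has total mass one. -/
theorem sum_prod_eq_one {p : α → ℝ} (hp : ∑ a, p a = 1) (n : ℕ) :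
    ∑ x : Fin n → α, ∏ i, p (x i) = 1 := by
  rw [← Fintype.sum_pow, hp, one_pow]

/-- Splitting off the first letter in a sum over words. -/
theorem sum_word_succ (n : ℕ) (g : (Fin (n + 1) → α) → ℝ) :
    ∑ x, g x = ∑ a, ∑ y : Fin n → α, g (Fin.cons a y) := by
  rw [← Fintype.sum_prod_type']
  exact (Fintype.sum_equiv (Fin.consEquiv fun _ => α) _ _ fun _ => rfl).symm

/-- A sum of independent centred letters is centred. -/
theorem sum_prod_mul_sum_eq_zero {p c : α → ℝ} (hp : ∑ a, p a = 1) (hc : ∑ a, p a * c a = 0)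
    (n : ℕ) : ∑ x : Fin n → α, (∏ i, p (x i)) * ∑ i, c (x i) = 0 := by
  induction n with
  | zero => simp
  | succ n ih =>
    rw [sum_word_succ]
    have h : ∀ a, ∑ y : Fin n → α, (∏ i, p ((Fin.cons a y : Fin (n + 1) → α) i)) *
        ∑ i, c ((Fin.cons a y : Fin (n + 1) → α) i) = p a * c a := by
      intro a
      calc _ = ∑ y : Fin n → α, (p a * c a * (∏ i, p (y i)) +
            p a * ((∏ i, p (y i)) * ∑ i, c (y i))) := by
            refine Finset.sum_congr rfl fun y _ => ?_
            simp only [Fin.prod_univ_succ, Fin.sum_univ_succ, Fin.cons_zero, Fin.cons_succ]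
            ring
        _ = p a * c a := by
            rw [Finset.sum_add_distrib, ← Finset.mul_sum, ← Finset.mul_sum, ih,
              sum_prod_eq_one hp]
            ring
    simp_rw [h, hc]

/-- The variance of a sum of independent centred letters grows linearly. -/
theorem sum_prod_mul_sum_sq {p c : α → ℝ} (hp : ∑ a, p a = 1) (hc : ∑ a, p a * c a = 0)
    (n : ℕ) : ∑ x : Fin n → α, (∏ i, p (x i)) * (∑ i, c (x i)) ^ 2 =
      n * ∑ a, p a * c a ^ 2 := by
  induction n with
  | zero => simp
  | succ n ih =>
    rw [sum_word_succ]
    have h : ∀ a, ∑ y : Fin n → α, (∏ i, p ((Fin.cons a y : Fin (n + 1) → α) i)) *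
        (∑ i, c ((Fin.cons a y : Fin (n + 1) → α) i)) ^ 2 =
          p a * c a ^ 2 + p a * (n * ∑ a, p a * c a ^ 2) := by
      intro a
      -- Expanding the square, the cross term vanishes because the tail is centred.
      calc _ = ∑ y : Fin n → α, (p a * c a ^ 2 * (∏ i, p (y i)) +
            2 * p a * c a * ((∏ i, p (y i)) * ∑ i, c (y i)) +
            p a * ((∏ i, p (y i)) * (∑ i, c (y i)) ^ 2)) := by
            refine Finset.sum_congr rfl fun y _ => ?_
            simp only [Fin.prod_univ_succ, Fin.sum_univ_succ, Fin.cons_zero, Fin.cons_succ]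
            ring
        _ = _ := by
            rw [Finset.sum_add_distrib, Finset.sum_add_distrib, ← Finset.mul_sum,
              ← Finset.mul_sum, ← Finset.mul_sum, ih, sum_prod_eq_one hp,
              sum_prod_mul_sum_eq_zero hp hc]
            ring
    simp_rw [h]
    rw [Finset.sum_add_distrib, ← Finset.sum_mul, hp]
    push_cast
    ring

open Classical in
/-- Chebyshev's inequality for words with independent letters. -/
theorem chebyshev_word {p c : α → ℝ} (hp0 : ∀ a, 0 ≤ p a) (hp : ∑ a, p a = 1)
    (hc : ∑ a, p a * c a = 0) {n : ℕ} (hn : 0 < n) {δ : ℝ} (hδ : 0 < δ) :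
    1 - (∑ a, p a * c a ^ 2) / (δ ^ 2 * n) ≤
      ∑ x : Fin n → α with |∑ i, c (x i)| ≤ δ * n, ∏ i, p (x i) := by
  have hn' : (0 : ℝ) < n := by exact_mod_cast hn
  have hsplit := Finset.sum_filter_add_sum_filter_not (Finset.univ : Finset (Fin n → α))
    (fun x => |∑ i, c (x i)| ≤ δ * n) (fun x => ∏ i, p (x i))
  rw [sum_prod_eq_one hp] at hsplit
  -- Markov's inequality for the squared deviation.
  have hbad : (∑ x : Fin n → α with ¬ |∑ i, c (x i)| ≤ δ * n, ∏ i, p (x i)) * (δ * n) ^ 2 ≤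
      n * ∑ a, p a * c a ^ 2 := by
    rw [← sum_prod_mul_sum_sq hp hc n, Finset.sum_mul]
    refine (Finset.sum_le_sum fun x hx => ?_).trans
      (Finset.sum_le_sum_of_subset_of_nonneg (Finset.filter_subset _ _) fun x _ _ =>
        mul_nonneg (Finset.prod_nonneg fun i _ => hp0 _) (sq_nonneg _))
    refine mul_le_mul_of_nonneg_left ?_ (Finset.prod_nonneg fun i _ => hp0 _)
    rw [Finset.mem_filter, not_le] at hx
    rw [← sq_abs (∑ i, c (x i))]
    exact pow_le_pow_left₀ (by positivity) hx.2.le 2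
  have : ∑ x : Fin n → α with ¬ |∑ i, c (x i)| ≤ δ * n, ∏ i, p (x i) ≤
      (∑ a, p a * c a ^ 2) / (δ ^ 2 * n) := by
    rw [le_div_iff₀ (by positivity)]
    refine le_of_mul_le_mul_right ?_ hn'
    calc _ = _ := by ring
      _ ≤ _ := hbad
      _ = _ := by ring
  linarith

/-! ### Ball sizes over a weighted alphabet -/

/-- The words of length `n` whose additive weight is at most `r`. -/
def weightBall (w : α → ℝ) (n : ℕ) (r : ℝ) : Set (Fin n → α) :=
  {x | ∑ i, w (x i) ≤ r}

/-- The weight enumerator of an alphabet with real weights. -/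
noncomputable def weightEnumerator (w : α → ℝ) (s : ℝ) : ℝ := ∑ a, s ^ w a

/-- The mean weight of a letter under the distribution proportional to `s ^ w`. -/
noncomputable def tiltedMean (w : α → ℝ) (s : ℝ) : ℝ := (∑ a, w a * s ^ w a) / weightEnumerator w s

theorem weightEnumerator_pos [Nonempty α] (w : α → ℝ) {s : ℝ} (hs : 0 < s) :
    0 < weightEnumerator w s :=
  Finset.sum_pos (fun _ _ => Real.rpow_pos_of_pos hs _) Finset.univ_nonempty

open Classical in
/-- The exponential-moment bound on the size of a ball. -/
theorem ncard_weightBall_mul_le (w : α → ℝ) {s : ℝ} (hs : 0 < s) (hs1 : s ≤ 1)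
    (n : ℕ) (r : ℝ) :
    ((weightBall w n r).ncard : ℝ) * s ^ r ≤ weightEnumerator w s ^ n := by
  rw [weightEnumerator, Fintype.sum_pow, Set.ncard_eq_toFinset_card', ← nsmul_eq_mul,
    ← Finset.sum_const]
  refine (Finset.sum_le_sum fun x hx => ?_).trans
    (Finset.sum_le_sum_of_subset_of_nonneg (Finset.subset_univ _) fun x _ _ =>
      Finset.prod_nonneg fun i _ => (Real.rpow_pos_of_pos hs _).le)
  rw [← Real.rpow_sum_of_pos hs]
  have hxr : x ∈ weightBall w n r := Set.mem_toFinset.1 hx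
  exact Real.rpow_le_rpow_of_exponent_ge hs hs1 hxr

/-- Nonemptiness matters: as `Real.log 0 = 0`, an empty ball would give `0` on the left, while the
right side can be negative when `r < 0`. -/
theorem log_ncard_weightBall_le [Nonempty α] (w : α → ℝ) {s : ℝ} (hs : 0 < s) (hs1 : s ≤ 1)
    {n : ℕ} (hn : 0 < n) {r : ℝ} (hne : (weightBall w n r).Nonempty) :
    Real.log ((weightBall w n r).ncard : ℝ) / n ≤
      Real.log (weightEnumerator w s) - r / n * Real.log s := by
  have hn' : (0 : ℝ) < n := by exact_mod_cast hn
  have hcard : (0 : ℝ) < (weightBall w n r).ncard := by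
    exact_mod_cast (Set.ncard_pos (Set.toFinite _)).2 hne
  have h := Real.log_le_log (by positivity) (ncard_weightBall_mul_le w hs hs1 n r)
  rw [Real.log_mul hcard.ne' (Real.rpow_pos_of_pos hs _).ne', Real.log_rpow hs,
    Real.log_pow] at h
  rw [div_le_iff₀ hn', sub_mul]
  have : r / n * Real.log s * n = r * Real.log s := by field_simp
  linarith

open Classical in
/-- Typical words under the tilted distribution give a lower bound on the size of a ball. -/
theorem half_le_ncard_weightBall_mul [Nonempty α] (w : α → ℝ) {s : ℝ} (hs : 0 < s)
    (hs1 : s ≤ 1) {δ : ℝ} (hδ : 0 < δ) :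
    ∀ᶠ n : ℕ in atTop, ∀ r : ℝ, (tiltedMean w s + δ) * n ≤ r →
      1 / 2 * weightEnumerator w s ^ n ≤
        (weightBall w n r).ncard * s ^ ((tiltedMean w s - δ) * n) := by
  set Z := weightEnumerator w s with hZdef
  set M := tiltedMean w s with hMdef
  have hZ : 0 < Z := weightEnumerator_pos w hs
  have hMZ : M * Z = ∑ a, w a * s ^ w a := div_mul_cancel₀ _ hZ.ne'
  set p : α → ℝ := fun a => s ^ w a / Z with hpdef
  set c : α → ℝ := fun a => w a - M with hcdef
  have hp0 : ∀ a, 0 ≤ p a := fun a => div_nonneg (Real.rpow_pos_of_pos hs _).le hZ.le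
  have hp : ∑ a, p a = 1 := by
    rw [hpdef, ← Finset.sum_div]
    exact div_self hZ.ne'
  have hc : ∑ a, p a * c a = 0 := by
    have h : ∀ a, p a * c a = (w a * s ^ w a) / Z - M * p a := fun a => by
      simp only [hpdef, hcdef]; ring
    simp_rw [h]
    rw [Finset.sum_sub_distrib, ← Finset.sum_div, ← Finset.mul_sum, hp, ← hMZ]
    field_simp
    ring
  set V := ∑ a, p a * c a ^ 2
  have hlim : Tendsto (fun n : ℕ => V / (δ ^ 2 * (n : ℝ))) atTop (𝓝 0) :=
    tendsto_const_nhds.div_atTop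
      (tendsto_natCast_atTop_atTop.const_mul_atTop (by positivity))
  filter_upwards [hlim.eventually_le_const (show (0 : ℝ) < 1 / 2 by norm_num),
    eventually_gt_atTop 0] with n hV hn r hr
  have hcheb := chebyshev_word hp0 hp hc hn hδ
  have hsum : ∀ x : Fin n → α, ∑ i, c (x i) = ∑ i, w (x i) - M * n := fun x => by
    simp [hcdef, Finset.sum_sub_distrib, mul_comm]
  have hprod : ∀ x : Fin n → α, ∏ i, p (x i) = s ^ (∑ i, w (x i)) / Z ^ n := fun x => by
    simp [hpdef, Finset.prod_div_distrib, Real.rpow_sum_of_pos hs]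
  -- The upper deviation bound puts typical words in the ball; the lower one, with `s ≤ 1`, caps
  -- their probability.
  have hle : ∑ x : Fin n → α with |∑ i, c (x i)| ≤ δ * n, ∏ i, p (x i) ≤
      (weightBall w n r).ncard * (s ^ ((M - δ) * n) / Z ^ n) := by
    rw [Set.ncard_eq_toFinset_card', ← nsmul_eq_mul]
    have hcardle : (Finset.univ.filter fun x : Fin n → α => |∑ i, c (x i)| ≤ δ * n).card ≤
        (weightBall w n r).toFinset.card := by
      refine Finset.card_le_card fun x hx => ?_
      rw [Finset.mem_filter, hsum, abs_le] at hx
      rw [Set.mem_toFinset]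
      change ∑ i, w (x i) ≤ r
      linarith [hx.2.2]
    refine (Finset.sum_le_card_nsmul _ _ _ fun x hx => ?_).trans
      (nsmul_le_nsmul_left (by positivity) hcardle)
    rw [Finset.mem_filter, hsum, abs_le] at hx
    rw [hprod]
    refine div_le_div_of_nonneg_right ?_ (by positivity)
    exact Real.rpow_le_rpow_of_exponent_ge hs hs1 (by linarith [hx.2.1])
  have h : 1 / 2 ≤ (weightBall w n r).ncard * s ^ ((M - δ) * n) / Z ^ n := by
    rw [mul_div_assoc]
    linarith
  rwa [le_div_iff₀ (by positivity)] at h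

/-- The exponential growth rate of balls is at least that of any tilting with a smaller mean. -/
theorem eventually_lt_log_ncard_weightBall [Nonempty α] (w : α → ℝ) {s : ℝ} (hs : 0 < s)
    (hs1 : s ≤ 1) {u : ℕ → ℝ} {U : ℝ}
    (hU : Tendsto (fun n : ℕ => u n / (n : ℝ)) atTop (𝓝 U)) (hlt : tiltedMean w s < U)
    {b : ℝ} (hb : b < Real.log (weightEnumerator w s) - tiltedMean w s * Real.log s) :
    ∀ᶠ n : ℕ in atTop, b < Real.log ((weightBall w n (u n)).ncard : ℝ) / n := by
  set Z := weightEnumerator w s with hZdef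
  set M := tiltedMean w s with hMdef
  have hZ : 0 < Z := weightEnumerator_pos w hs
  -- Both strict inequalities hold at `δ = 0`, hence for small `δ > 0`.
  obtain ⟨δ, hbδ, hδU, hδ⟩ : ∃ δ : ℝ, b < Real.log Z - (M - δ) * Real.log s ∧ M + δ < U ∧
      0 < δ := by
    have h1 : Tendsto (fun δ : ℝ => Real.log Z - (M - δ) * Real.log s) (𝓝[>] 0)
        (𝓝 (Real.log Z - (M - 0) * Real.log s)) :=
      ((by fun_prop : Continuous fun δ : ℝ => Real.log Z - (M - δ) * Real.log s).tendsto 0).mono_left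
        nhdsWithin_le_nhds
    have h2 : Tendsto (fun δ : ℝ => M + δ) (𝓝[>] 0) (𝓝 (M + 0)) :=
      ((by fun_prop : Continuous fun δ : ℝ => M + δ).tendsto 0).mono_left nhdsWithin_le_nhds
    exact ((h1.eventually_const_lt (by simpa using hb)).and
      ((h2.eventually_lt_const (by simpa using hlt)).and self_mem_nhdsWithin)).exists
  have hlim : Tendsto (fun n : ℕ => Real.log (1 / 2) / (n : ℝ) +
      (Real.log Z - (M - δ) * Real.log s)) atTop
      (𝓝 (0 + (Real.log Z - (M - δ) * Real.log s))) :=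
    (tendsto_const_nhds.div_atTop tendsto_natCast_atTop_atTop).add_const _
  filter_upwards [half_le_ncard_weightBall_mul w hs hs1 hδ, eventually_gt_atTop 0,
    hU.eventually_const_lt hδU, hlim.eventually_const_lt (by simpa using hbδ)]
    with n hn hn0 hun hbn
  have hn' : (0 : ℝ) < n := by exact_mod_cast hn0
  have h := hn (u n) ((lt_div_iff₀ hn').1 hun).le
  have hspos := Real.rpow_pos_of_pos hs ((M - δ) * n)
  have hcard : (0 : ℝ) < (weightBall w n (u n)).ncard :=
    pos_of_mul_pos_left (lt_of_lt_of_le (by positivity) h) hspos.le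
  have hl := Real.log_le_log (by positivity) h
  rw [Real.log_mul (by norm_num) (by positivity), Real.log_pow,
    Real.log_mul hcard.ne' hspos.ne', Real.log_rpow hs] at hl
  refine hbn.trans_le ?_
  rw [le_div_iff₀ hn']
  have : (Real.log (1 / 2) / n + (Real.log Z - (M - δ) * Real.log s)) * n =
      Real.log (1 / 2) + n * Real.log Z - (M - δ) * n * Real.log s := by
    field_simp
    ring
  linarith

end Alphabet

/-! ### Weights and tilted means for a field extension -/

section Subfield

variable (F K : Type*) [Field F] [Field K] [Algebra F K]

/-- Sums over the extension field of a function of the subfield weight. -/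
theorem sum_comp_subfieldWeight [Fintype F] [Fintype K] (lam : ℝ) (g : ℝ → ℝ) :
    ∑ x : K, g (subfieldWeight F lam x) =
      g 0 + ((Fintype.card F : ℝ) - 1) * g 1 +
        ((Fintype.card K : ℝ) - Fintype.card F) * g lam := by
  classical
  have hinj : Function.Injective (algebraMap F K) := (algebraMap F K).injective
  set R : Finset K := Finset.univ.image (algebraMap F K) with hR
  have hRcard : R.card = Fintype.card F := by
    rw [hR, Finset.card_image_of_injective _ hinj, Finset.card_univ]
  have hin : ∑ x ∈ R, g (subfieldWeight F lam x) = g 0 + ((Fintype.card F : ℝ) - 1) * g 1 := by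
    rw [hR, Finset.sum_image hinj.injOn,
      ← Finset.add_sum_erase _ _ (Finset.mem_univ (0 : F))]
    congr 1
    · simp [subfieldWeight]
    · rw [Finset.sum_congr rfl (g := fun _ => g 1), Finset.sum_const,
        Finset.card_erase_of_mem (Finset.mem_univ _), Finset.card_univ, nsmul_eq_mul,
        Nat.cast_sub Fintype.card_pos, Nat.cast_one]
      intro a ha
      have ha0 : a ≠ 0 := Finset.ne_of_mem_erase ha
      simp [subfieldWeight, ha0]
  have hout : ∑ x ∈ Rᶜ, g (subfieldWeight F lam x) =
      ((Fintype.card K : ℝ) - Fintype.card F) * g lam := by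
    rw [Finset.sum_congr rfl (g := fun _ => g lam), Finset.sum_const, Finset.card_compl,
      nsmul_eq_mul, Nat.cast_sub (Finset.card_le_univ _), hRcard]
    intro x hx
    have hx' : x ∉ Set.range (algebraMap F K) := by simpa [hR] using hx
    have hx0 : x ≠ 0 := fun h => hx' ⟨0, by simp [h]⟩
    rw [subfieldWeight, if_neg hx0, if_neg hx']
  rw [← Finset.sum_add_sum_compl R, hin, hout]

theorem nonempty_subfieldBall (lam : ℝ) (n : ℕ) {r : ℝ} (hr : 0 ≤ r) :
    (subfieldBall F K lam n r).Nonempty :=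
  ⟨0, by simpa [subfieldBall, subfieldWeightVec, subfieldWeight] using hr⟩

theorem log_ncard_subfieldBall_nonneg (lam : ℝ) (n : ℕ) (r : ℝ) :
    0 ≤ Real.log ((subfieldBall F K lam n r).ncard : ℝ) / n :=
  div_nonneg (Real.log_natCast_nonneg _) n.cast_nonneg

end Subfield

/-- The mean weight of the tilted distribution on the extension field. -/
noncomputable def subfieldTiltedMean (q m : ℕ) (lam x : ℝ) : ℝ :=
  (x * ((q : ℝ) - 1) + lam * ((q : ℝ) ^ m - q) * x ^ lam) / subfieldEnumerator q m lam x

theorem subfieldEnumerator_pos {q m : ℕ} (hq : 2 ≤ q) (hm : 1 ≤ m) {lam x : ℝ}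
    (hx : 0 ≤ x) : 0 < subfieldEnumerator q m lam x := by
  have hq' : (2 : ℝ) ≤ q := by exact_mod_cast hq
  have h1 : (q : ℝ) ≤ (q : ℝ) ^ m := le_self_pow₀ (by linarith) (by omega)
  have h2 : 0 ≤ ((q : ℝ) - 1) * x := mul_nonneg (by linarith) hx
  have h3 : 0 ≤ ((q : ℝ) ^ m - q) * x ^ lam :=
    mul_nonneg (by linarith) (Real.rpow_nonneg hx _)
  rw [subfieldEnumerator]
  linarith

/-- After cross-multiplication the difference is `a (t - s) + lam b (t ^ lam - s ^ lam)` plus `a b`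
times the term in `hcross`, with `a = q - 1 > 0` and `b = q ^ m - q ≥ 0`. -/
theorem subfieldTiltedMean_lt {q m : ℕ} (hq : 2 ≤ q) (hm : 1 ≤ m) {lam s t : ℝ}
    (hlam : 0 < lam) (hs : 0 < s) (hst : s < t) :
    subfieldTiltedMean q m lam s < subfieldTiltedMean q m lam t := by
  have ht : 0 < t := hs.trans hst
  rw [subfieldTiltedMean, subfieldTiltedMean,
    div_lt_div_iff₀ (subfieldEnumerator_pos hq hm hs.le) (subfieldEnumerator_pos hq hm ht.le),
    subfieldEnumerator, subfieldEnumerator]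
  have hq' : (2 : ℝ) ≤ q := by exact_mod_cast hq
  have hb : 0 ≤ (q : ℝ) ^ m - q := sub_nonneg.2 (le_self_pow₀ (by linarith) (by omega))
  have ha : 0 < (q : ℝ) - 1 := by linarith
  set a := (q : ℝ) - 1
  set b := (q : ℝ) ^ m - q
  have hpow : s ^ lam < t ^ lam := Real.rpow_lt_rpow hs.le hst hlam
  -- Both factors change sign together at `lam = 1`.
  have hcross : 0 ≤ (1 - lam) * (t * s ^ lam - s * t ^ lam) := by
    have h1 : t * s ^ lam - s * t ^ lam = s * t * (s ^ (lam - 1) - t ^ (lam - 1)) := by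
      rw [Real.rpow_sub_one hs.ne', Real.rpow_sub_one ht.ne']
      field_simp
    rw [h1]
    rcases le_total lam 1 with h | h
    · have := Real.rpow_le_rpow_of_nonpos hs hst.le (sub_nonpos.2 h)
      exact mul_nonneg (sub_nonneg.2 h) (mul_nonneg (by positivity) (sub_nonneg.2 this))
    · have := Real.rpow_le_rpow hs.le hst.le (sub_nonneg.2 h)
      exact mul_nonneg_of_nonpos_of_nonpos (sub_nonpos.2 h)
        (mul_nonpos_of_nonneg_of_nonpos (by positivity) (sub_nonpos.2 this))
  have h1 : 0 < a * (t - s) := mul_pos ha (sub_pos.2 hst)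
  have h2 : 0 ≤ lam * b * (t ^ lam - s ^ lam) :=
    mul_nonneg (mul_nonneg hlam.le hb) (sub_pos.2 hpow).le
  have h3 := mul_nonneg (mul_nonneg ha.le hb) hcross
  linear_combination h1 + h2 + h3

theorem continuous_subfieldEnumerator (q m : ℕ) {lam : ℝ} (hlam : 0 ≤ lam) :
    Continuous (subfieldEnumerator q m lam) := by
  unfold subfieldEnumerator
  have := Real.continuous_rpow_const hlam
  fun_prop

theorem continuousAt_subfieldTiltedMean {q m : ℕ} (hq : 2 ≤ q) (hm : 1 ≤ m) {lam x : ℝ}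
    (hlam : 0 ≤ lam) (hx : 0 ≤ x) : ContinuousAt (subfieldTiltedMean q m lam) x := by
  unfold subfieldTiltedMean
  have := Real.continuous_rpow_const hlam
  exact ContinuousAt.div (by fun_prop) (continuous_subfieldEnumerator q m hlam).continuousAt
    (subfieldEnumerator_pos hq hm hx).ne'

theorem subfieldEnumerator_one (q m : ℕ) (lam : ℝ) :
    subfieldEnumerator q m lam 1 = (q : ℝ) ^ m := by
  rw [subfieldEnumerator, Real.one_rpow]
  ring

/-! ### Growth rates in the three ranges of the tilting parameter -/

section Growth

variable (F K : Type*) [Field F] [Fintype F] [Field K] [Fintype K] [Algebra F K]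

theorem weightEnumerator_subfieldWeight (lam s : ℝ) :
    weightEnumerator (subfieldWeight F lam : K → ℝ) s =
      subfieldEnumerator (Fintype.card F) (Module.finrank F K) lam s := by
  rw [weightEnumerator, sum_comp_subfieldWeight F K lam (fun t => s ^ t), subfieldEnumerator,
    Module.card_eq_pow_finrank (K := F) (V := K)]
  simp

theorem tiltedMean_subfieldWeight (lam s : ℝ) :
    tiltedMean (subfieldWeight F lam : K → ℝ) s =
      subfieldTiltedMean (Fintype.card F) (Module.finrank F K) lam s := by
  rw [tiltedMean, weightEnumerator_subfieldWeight,
    sum_comp_subfieldWeight F K lam (fun t => t * s ^ t), subfieldTiltedMean,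
    Module.card_eq_pow_finrank (K := F) (V := K)]
  congr 1
  push_cast
  rw [Real.rpow_one]
  ring

theorem two_le_card : 2 ≤ Fintype.card F := Fintype.one_lt_card

/-- The growth rate of balls, in natural logarithms, for a tilting parameter in `(0, 1]`. -/
theorem tendsto_log_ncard_subfieldBall_of_pos {lam : ℝ} (hlam : 0 < lam) {u : ℕ → ℝ}
    (hu : ∀ n, 0 ≤ u n) {U : ℝ} (hU : Tendsto (fun n : ℕ => u n / (n : ℝ)) atTop (𝓝 U))
    {ρ : ℝ} (hρ : 0 < ρ) (hρ1 : ρ ≤ 1)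
    (hsol : U = subfieldTiltedMean (Fintype.card F) (Module.finrank F K) lam ρ) :
    Tendsto (fun n : ℕ => Real.log ((subfieldBall F K lam n (u n)).ncard : ℝ) / n) atTop
      (𝓝 (Real.log (subfieldEnumerator (Fintype.card F) (Module.finrank F K) lam ρ) -
        U * Real.log ρ)) := by
  have hq := two_le_card F
  have hm : 1 ≤ Module.finrank F K := Module.finrank_pos
  rw [tendsto_order]
  constructor
  · intro b hb
    have hcont : ContinuousAt (fun s =>
        Real.log (subfieldEnumerator (Fintype.card F) (Module.finrank F K) lam s) -
          subfieldTiltedMean (Fintype.card F) (Module.finrank F K) lam s * Real.log s) ρ :=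
      ((continuous_subfieldEnumerator _ _ hlam.le).continuousAt.log
        (subfieldEnumerator_pos hq hm hρ.le).ne').sub
        ((continuousAt_subfieldTiltedMean hq hm hlam.le hρ.le).mul
          (Real.continuousAt_log hρ.ne'))
    rw [hsol] at hb
    -- Tilting slightly left of `ρ` leaves room between the mean and `U`.
    have hleft := (hcont.tendsto.eventually_const_lt hb).filter_mono
      (nhdsWithin_le_nhds (s := Set.Iio ρ))
    obtain ⟨s, hbs, hs0, hsρ⟩ := (hleft.and
      (((eventually_gt_nhds hρ).filter_mono nhdsWithin_le_nhds).and self_mem_nhdsWithin)).exists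
    refine eventually_lt_log_ncard_weightBall (subfieldWeight F lam : K → ℝ) hs0
      (le_trans (le_of_lt hsρ) hρ1) hU ?_ ?_
    · rw [tiltedMean_subfieldWeight, hsol]
      exact subfieldTiltedMean_lt hq hm hlam hs0 hsρ
    · rwa [tiltedMean_subfieldWeight, weightEnumerator_subfieldWeight]
  · intro b hb
    have hlim := (hU.mul_const (Real.log ρ)).const_sub
      (Real.log (subfieldEnumerator (Fintype.card F) (Module.finrank F K) lam ρ))
    filter_upwards [hlim.eventually_lt_const hb, eventually_gt_atTop 0] with n hn hn0
    refine lt_of_le_of_lt ?_ hn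
    rw [← weightEnumerator_subfieldWeight]
    exact log_ncard_weightBall_le _ hρ hρ1 hn0 (nonempty_subfieldBall F K lam n (hu n))

/-- Balls of sublinear radius grow subexponentially. -/
theorem tendsto_log_ncard_subfieldBall_of_zero {lam : ℝ} (hlam : 0 < lam) {u : ℕ → ℝ}
    (hu : ∀ n, 0 ≤ u n) (hU : Tendsto (fun n : ℕ => u n / (n : ℝ)) atTop (𝓝 0)) :
    Tendsto (fun n : ℕ => Real.log ((subfieldBall F K lam n (u n)).ncard : ℝ) / n) atTop
      (𝓝 0) := by
  rw [tendsto_order]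
  refine ⟨fun b hb => Eventually.of_forall fun n =>
    hb.trans_le (log_ncard_subfieldBall_nonneg F K lam n _), fun b hb => ?_⟩
  have h0 : subfieldEnumerator (Fintype.card F) (Module.finrank F K) lam 0 = 1 := by
    simp [subfieldEnumerator, Real.zero_rpow hlam.ne']
  have hcont : ContinuousAt (fun s =>
      Real.log (subfieldEnumerator (Fintype.card F) (Module.finrank F K) lam s)) 0 :=
    (continuous_subfieldEnumerator _ _ hlam.le).continuousAt.log (by simp [h0])
  -- Fix `s > 0` with `log f(s) < b`; the term `u n / n * log s` then tends to `0`.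
  have hright := (hcont.tendsto.eventually_lt_const (by simpa [h0] using hb)).filter_mono
    (nhdsWithin_le_nhds (s := Set.Ioi 0))
  obtain ⟨s, hbs, hs1, hs0⟩ := (hright.and (((eventually_lt_nhds
    (zero_lt_one' ℝ)).filter_mono nhdsWithin_le_nhds).and self_mem_nhdsWithin)).exists
  have hlim := (hU.mul_const (Real.log s)).const_sub
    (Real.log (subfieldEnumerator (Fintype.card F) (Module.finrank F K) lam s))
  filter_upwards [hlim.eventually_lt_const (by simpa using hbs), eventually_gt_atTop 0]
    with n hn hn0
  refine lt_of_le_of_lt ?_ hn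
  rw [← weightEnumerator_subfieldWeight]
  exact log_ncard_weightBall_le _ hs0 hs1.le hn0 (nonempty_subfieldBall F K lam n (hu n))

/-- Balls of radius beyond the average weight have full exponential growth rate. -/
theorem tendsto_log_ncard_subfieldBall_of_one_lt {lam : ℝ} {u : ℕ → ℝ}
    (hu : ∀ n, 0 ≤ u n) {U : ℝ} (hU : Tendsto (fun n : ℕ => u n / (n : ℝ)) atTop (𝓝 U))
    (hlt : subfieldTiltedMean (Fintype.card F) (Module.finrank F K) lam 1 < U) :
    Tendsto (fun n : ℕ => Real.log ((subfieldBall F K lam n (u n)).ncard : ℝ) / n) atTop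
      (𝓝 (Real.log ((Fintype.card F : ℝ) ^ Module.finrank F K))) := by
  rw [tendsto_order]
  constructor
  · intro b hb
    refine eventually_lt_log_ncard_weightBall (subfieldWeight F lam : K → ℝ) one_pos le_rfl
      hU ?_ ?_
    · rwa [tiltedMean_subfieldWeight]
    · rwa [weightEnumerator_subfieldWeight, subfieldEnumerator_one, Real.log_one, mul_zero,
        sub_zero]
  · intro b hb
    filter_upwards [eventually_gt_atTop 0] with n hn0
    refine lt_of_le_of_lt ?_ hb
    have h := log_ncard_weightBall_le (subfieldWeight F lam : K → ℝ) one_pos le_rfl hn0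
      (nonempty_subfieldBall F K lam n (hu n))
    rwa [weightEnumerator_subfieldWeight, subfieldEnumerator_one, Real.log_one, mul_zero,
      sub_zero] at h

end Growth

/-! ### The theorem in base `q ^ m` -/

theorem mainTheorem8 (F K : Type*) [Field F] [Finite F] [Field K] [Finite K] [Algebra F K]
    (q m : ℕ) (hq : Nat.card F = q) (hm : Module.finrank F K = m)
    (lam : ℝ) (hlam : 1 / 2 ≤ lam)
    (u : ℕ → ℝ) (hu : ∀ n, 0 ≤ u n)
    (U : ℝ) (hU : Tendsto (fun n : ℕ => u n / (n : ℝ)) atTop (𝓝 U))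
    (ρ : ℝ) (hρ : 0 ≤ ρ)
    (hsol : U = (ρ * ((q : ℝ) - 1) + lam * ((q : ℝ) ^ m - q) * ρ ^ lam) /
      (1 + ρ * ((q : ℝ) - 1) + ((q : ℝ) ^ m - q) * ρ ^ lam)) :
    (ρ ≤ 1 →
      Tendsto
        (fun n : ℕ => 1 / (n : ℝ) *
          Real.logb ((q : ℝ) ^ m) ((subfieldBall F K lam n (u n)).ncard : ℝ))
        atTop
        (𝓝 (Real.logb ((q : ℝ) ^ m) (subfieldEnumerator q m lam ρ)
          - U * Real.logb ((q : ℝ) ^ m) ρ))) ∧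
    (1 < ρ →
      Tendsto
        (fun n : ℕ => 1 / (n : ℝ) *
          Real.logb ((q : ℝ) ^ m) ((subfieldBall F K lam n (u n)).ncard : ℝ))
        atTop (𝓝 1)) := by
  classical
  cases nonempty_fintype F
  cases nonempty_fintype K
  have hlam0 : 0 < lam := by linarith
  rw [Nat.card_eq_fintype_card] at hq
  subst hq hm
  have hF := two_le_card F
  have hm1 : 1 ≤ Module.finrank F K := Module.finrank_pos
  have hsol' : U = subfieldTiltedMean (Fintype.card F) (Module.finrank F K) lam ρ := by
    rw [hsol, subfieldTiltedMean, subfieldEnumerator, mul_comm ρ]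
  have hF' : (1 : ℝ) < Fintype.card F := by exact_mod_cast hF
  have hbase : 0 < Real.log ((Fintype.card F : ℝ) ^ Module.finrank F K) :=
    Real.log_pos (one_lt_pow₀ hF' (by omega))
  have hfun : (fun n : ℕ => 1 / (n : ℝ) *
      Real.logb ((Fintype.card F : ℝ) ^ Module.finrank F K)
        ((subfieldBall F K lam n (u n)).ncard : ℝ)) =
      fun n : ℕ => Real.log ((subfieldBall F K lam n (u n)).ncard : ℝ) / n /
        Real.log ((Fintype.card F : ℝ) ^ Module.finrank F K) := by
    funext n
    rw [Real.logb]
    ring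
  rw [hfun]
  refine ⟨fun hρ1 => ?_, fun hρ1 => ?_⟩
  · have hval : Real.logb ((Fintype.card F : ℝ) ^ Module.finrank F K)
        (subfieldEnumerator (Fintype.card F) (Module.finrank F K) lam ρ) -
        U * Real.logb ((Fintype.card F : ℝ) ^ Module.finrank F K) ρ =
        (Real.log (subfieldEnumerator (Fintype.card F) (Module.finrank F K) lam ρ) -
          U * Real.log ρ) / Real.log ((Fintype.card F : ℝ) ^ Module.finrank F K) := by
      rw [Real.logb, Real.logb]
      ring
    rw [hval]
    refine Tendsto.div_const ?_ _
    rcases hρ.eq_or_lt with rfl | hpos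
    · have hU0 : U = 0 := by simpa [Real.zero_rpow hlam0.ne'] using hsol
      subst hU0
      simpa [subfieldEnumerator, Real.zero_rpow hlam0.ne'] using
        tendsto_log_ncard_subfieldBall_of_zero F K hlam0 hu hU
    · exact tendsto_log_ncard_subfieldBall_of_pos F K hlam0 hu hU hpos hρ1 hsol'
  · rw [← div_self hbase.ne']
    refine (tendsto_log_ncard_subfieldBall_of_one_lt F K hu hU ?_).div_const _
    rw [hsol']
    exact subfieldTiltedMean_lt hF hm1 hlam0 one_pos hρ1
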